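/- Let $\mathcal X$ be a metric space with a finite positive Borel measure $\omega$ of full support, and let $k:\mathcal X\times\mathcal X\to\mathbb R$ be a continuous symmetric positive definite kernel (all finite Gram matrices are positive semidefinite) such that $x\mapsto k(x,x)$ is bounded. Let $\mathcal F$ be the reproducing kernel Hilbert space of $k$, and let $\bm\Sigma g(x)=\int k(x,y)g(y)\,\mathrm d\omega(y)$ be the associated integral operator on $\mathbb L_2(\omega)$. Let $(e_m)_{m\ge1}$ be an orthonormal basis of $\mathbb L_2(\omega)$ consisting of continuous eigenfunctions, $\bm\Sigma e_m=\sigma_m e_m$, with positive non-increasing eigenvalues $(\sigma_m)_{m\geq 1}$. For $N\ge1$ let $\bm x=(x_1,\dots,x_N)$ follow the projection determinantal point process $$\frac1{N!}\det\Big(\sum_{m=1}^N e_m(x_i)e_m(x_j)\Big)_{1\le i,j\le N}\,\mathrm d\omega(x_1)\cdots \mathrm d\omega(x_N),$$ with expectation denoted by $\mathbb E_{\mathrm{DPP}}$, and for $f\in\mathcal F$ let $\hat f_{\mathrm{LS},\bm x}$ be the $\mathbb L_2(\omega)$-orthogonal projection of $f$ onto $\mathrm{Span}\{k(x_1,\cdot),\dots,k(x_N,\cdot)\}$.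 If there is $s>1/2$ such that $\sigma_m=m^{-2s}$ for all $m\ge1$, then for every $f\in\mathcal F$, $$\mathbb E_{\mathrm{DPP}}\|f-\hat f_{\mathrm{LS},\bm x}\|_{\mathbb L_2(\omega)}^2=\mathcal O\big(N^{1/2-2s}\big)\qquad (N\to\infty).$$ -/

import Mathlib

open MeasureTheory Filter Asymptotics
open scoped InnerProductSpace Topology

noncomputable section

namespace DPPSampling

variable {X : Type*} [MetricSpace X]

/-- A kernel `k : X × X → ℝ` on a metric space that is symmetric and positive definite (every
finite Gram matrix is symmetric positive semidefinite), continuous, and bounded on the diagonal. -/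
structure IsAdmissibleKernel (k : X → X → ℝ) : Prop where
  posSemidef : (Matrix.of k).PosSemidef
  continuous : Continuous (fun p : X × X => k p.1 p.2)
  bounded_diag : ∃ C : ℝ, ∀ x, k x x ≤ C

/-- `H` is the reproducing kernel Hilbert space of the real kernel `k`. Mathlib's kernel of an RKHS
takes values in the continuous linear maps `ℝ →L[ℝ] ℝ`, which are read as numbers. -/
def HasKernel (H : Type*) [NormedAddCommGroup H] [InnerProductSpace ℝ H] [CompleteSpace H]
    [RKHS ℝ H X ℝ] (k : X → X → ℝ) : Prop :=
  ∀ x y, RKHS.kernel H x y (1 : ℝ) = k x y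

section Rkhs

variable {H : Type*} [NormedAddCommGroup H] [InnerProductSpace ℝ H] [CompleteSpace H]
  [RKHS ℝ H X ℝ] {k : X → X → ℝ}

lemma HasKernel.inner_kerFun (h : HasKernel H k) (x y : X) :
    ⟪RKHS.kerFun H x (1 : ℝ), RKHS.kerFun H y (1 : ℝ)⟫_ℝ = k x y := by
  rw [RKHS.kerFun_inner, RKHS.kerFun_apply, h x y]
  simp

lemma HasKernel.continuous_kerFun (h : HasKernel H k) (hk : IsAdmissibleKernel k) :
    Continuous (fun x : X => RKHS.kerFun H x (1 : ℝ)) := by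
  have hc := hk.continuous
  rw [continuous_iff_continuousAt]
  intro a
  rw [ContinuousAt, tendsto_iff_norm_sub_tendsto_zero]
  have hs : ∀ x, ‖RKHS.kerFun H x (1 : ℝ) - RKHS.kerFun H a (1 : ℝ)‖
      = √(k x x - 2 * k x a + k a a) := by
    intro x
    rw [← Real.sqrt_sq (norm_nonneg _), @norm_sub_sq_real, ← real_inner_self_eq_norm_sq,
      ← real_inner_self_eq_norm_sq, h.inner_kerFun, h.inner_kerFun, h.inner_kerFun]
  simp_rw [hs]
  have h1 : Continuous (fun x => k x x) := hc.comp (continuous_id.prodMk continuous_id)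
  have h2 : Continuous (fun x => k x a) := hc.comp (continuous_id.prodMk continuous_const)
  have h3 : Continuous (fun x => √(k x x - 2 * k x a + k a a)) := by fun_prop
  have := h3.tendsto a
  convert this using 2
  rw [show k a a - 2 * k a a + k a a = 0 by ring, Real.sqrt_zero]

lemma HasKernel.apply_eq (f : H) (x : X) : f x = ⟪RKHS.kerFun H x (1 : ℝ), f⟫_ℝ := by
  rw [RKHS.kerFun_inner]
  simp

/-- The elements of the RKHS of an admissible kernel are square integrable for finite measures. -/
lemma HasKernel.memLp [MeasurableSpace X] [BorelSpace X] (h : HasKernel H k)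
    (hk : IsAdmissibleKernel k) (ω : Measure X) [IsFiniteMeasure ω] (f : H) :
    MemLp (fun x => f x) 2 ω := by
  obtain ⟨C, hC⟩ := hk.bounded_diag
  have hf : Continuous (fun x => f x) := by
    simp_rw [HasKernel.apply_eq f]
    exact (h.continuous_kerFun hk).inner continuous_const
  refine MemLp.of_bound hf.aestronglyMeasurable (√C * ‖f‖) (Eventually.of_forall fun x => ?_)
  rw [HasKernel.apply_eq f x]
  refine (norm_inner_le_norm _ _).trans ?_
  gcongr
  rw [← Real.sqrt_sq (norm_nonneg (RKHS.kerFun H x (1 : ℝ))), ← real_inner_self_eq_norm_sq,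
    h.inner_kerFun]
  exact Real.sqrt_le_sqrt (hC x)

end Rkhs

/-- Kernel translates `k(x, ·)` are square integrable for finite measures. -/
lemma IsAdmissibleKernel.memLp [MeasurableSpace X] [BorelSpace X] {k : X → X → ℝ}
    (hk : IsAdmissibleKernel k) (ω : Measure X) [IsFiniteMeasure ω] (x : X) :
    MemLp (fun y => k x y) 2 ω := by
  obtain ⟨C, hC⟩ := hk.bounded_diag
  have hc : Continuous (fun y => k x y) :=
    hk.continuous.comp (continuous_const.prodMk continuous_id)
  have key : ∀ a b : ℝ, ∀ y, 0 ≤ a * a * k x x + 2 * (a * b) * k x y + b * b * k y y := by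
    intro a b y
    have h0 := (hk.posSemidef.submatrix ![x, y]).dotProduct_mulVec_nonneg ![a, b]
    have hs : k y x = k x y := hk.posSemidef.isHermitian.apply x y
    simp [Matrix.mulVec, dotProduct, Fin.sum_univ_two, hs] at h0
    linarith
  refine MemLp.of_bound hc.aestronglyMeasurable C (Eventually.of_forall fun y => ?_)
  have h1 := key 1 1 y
  have h2 := key 1 (-1) y
  rw [Real.norm_eq_abs, abs_le]
  constructor <;> linarith [hC x, hC y]

variable [MeasurableSpace X]

/-- The integral operator `(Σ f)(x) = ∫ k(x, y) f(y) dω(y)`. -/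
def integralOperator (k : X → X → ℝ) (ω : Measure X) (f : X → ℝ) (x : X) : ℝ :=
  ∫ y, k x y * f y ∂ω

/-- Spectral data of the integral operator: an orthonormal basis `b` of `L²(ω)` of eigenvectors,
with positive non-increasing eigenvalues `σ`, and continuous representatives `e` of the basis
vectors. The index `m : ℕ` stands for the `(m + 1)`-st eigenpair. -/
structure IsEigensystem (k : X → X → ℝ) (ω : Measure X) (σ : ℕ → ℝ)
    (b : HilbertBasis ℕ ℝ (Lp ℝ 2 ω)) (e : ℕ → X → ℝ) : Prop where
  pos : ∀ m, 0 < σ m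
  antitone : Antitone σ
  eigen : ∀ m, integralOperator k ω (b m) =ᵐ[ω] fun x => σ m * b m x
  continuous : ∀ m, Continuous (e m)
  ae_eq : ∀ m, e m =ᵐ[ω] b m

/-- The kernel of the orthogonal projection onto the span of the first `N` eigenfunctions. -/
def projectionKernel (e : ℕ → X → ℝ) (N : ℕ) (x y : X) : ℝ :=
  ∑ m ∈ Finset.range N, e m x * e m y

/-- The law on `X ^ N` of the projection DPP with reference measure `ω` whose kernel is the
projection kernel of the first `N` eigenfunctions:
`(1 / N!) det (k₀(x_i, x_j)) dω(x_1) ⋯ dω(x_N)`. -/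
def dppLaw (ω : Measure X) [IsFiniteMeasure ω] (e : ℕ → X → ℝ) (N : ℕ) :
    Measure (Fin N → X) :=
  (Measure.pi fun _ : Fin N => ω).withDensity fun x =>
    ENNReal.ofReal ((1 / (N.factorial : ℝ)) *
      (Matrix.of fun i j : Fin N => projectionKernel e N (x i) (x j)).det)

variable [BorelSpace X]

/-- The kernel translate `k(x, ·)` as an element of `L²(ω)`. -/
def kernelTranslate {k : X → X → ℝ} (hk : IsAdmissibleKernel k) (ω : Measure X)
    [IsFiniteMeasure ω] (x : X) : Lp ℝ 2 ω :=
  (hk.memLp ω x).toLp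

/-- The span of the kernel translates at the nodes, as a subspace of `L²(ω)`. -/
def kernelSpan {k : X → X → ℝ} (hk : IsAdmissibleKernel k) (ω : Measure X)
    [IsFiniteMeasure ω] {N : ℕ} (x : Fin N → X) : Submodule ℝ (Lp ℝ 2 ω) :=
  Submodule.span ℝ (Set.range fun i => kernelTranslate hk ω (x i))

instance {k : X → X → ℝ} (hk : IsAdmissibleKernel k) (ω : Measure X)
    [IsFiniteMeasure ω] {N : ℕ} (x : Fin N → X) : FiniteDimensional ℝ (kernelSpan hk ω x) :=
  FiniteDimensional.span_of_finite ℝ (Set.finite_range _)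

/-- The least-squares approximation of `f` from the nodes `x`: the `L²(ω)`-orthogonal projection
of `f` onto the span of the kernel translates at the nodes. -/
def lsApprox {k : X → X → ℝ} (hk : IsAdmissibleKernel k) (ω : Measure X)
    [IsFiniteMeasure ω] {N : ℕ} (x : Fin N → X) (f : Lp ℝ 2 ω) : Lp ℝ 2 ω :=
  (kernelSpan hk ω x).starProjection f

end DPPSampling

end

namespace DPPSampling

/-! ### Integrals of products of determinants. -/

section Andreief

variable {X ι : Type*} [Fintype ι] {φ ψ : ι → X → ℝ}

/-! Let `A = (e_n(x_i))`; the DPP density is `(det A)² / N!`. For a target `g = ∑ σ_n v_n b_n` with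
`n < N`, solve `Aᵀ c = v`: then `∑ c_i k(x_i, ·)` has the same first `N` coefficients as `g`, and by
Cramer's rule its coefficient at `m ≥ N` is `σ_m / det A` times a combination of determinants in
which one `e_n` is replaced by `e_m`. The density cancels the singular factor `(det A)⁻²`, and
Andréief's identity with orthonormality gives expected squared error at most `(∑_{m ≥ N} σ_m²) ∑
v_n²`.

A general `f` in the RKHS satisfies `∑ ⟨b_m, f⟩² / σ_m ≤ ‖f‖²`. Keeping only the coefficients with
`σ_m ≥ τ ≥ σ_N` gives such a `g` with `∑ v_n² ≤ ‖f‖² / τ` and `‖f - g‖² ≤ τ ‖f‖²`. The tail of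
`σ_m²` is at most `N^(1 - 4s)`, so `τ = N^(1/2 - 2s)` balances the two errors. -/

lemma det_mul_det_eq_sum [DecidableEq ι] (x : ι → X) :
    (Matrix.of fun i j => φ i (x j)).det * (Matrix.of fun i j => ψ i (x j)).det
      = ∑ π : Equiv.Perm ι, ∑ ρ : Equiv.Perm ι, ((π.sign : ℤ) : ℝ) * ((ρ.sign : ℤ) : ℝ) *
        ((∏ i, φ (π i) (x i)) * ∏ i, ψ (ρ i) (x i)) := by
  rw [Matrix.det_apply', Matrix.det_apply', Finset.sum_mul_sum]
  refine Finset.sum_congr rfl fun π _ => Finset.sum_congr rfl fun ρ _ => ?_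
  simp only [Matrix.of_apply]
  ring

variable [MeasurableSpace X] (ω : Measure X) [IsFiniteMeasure ω]

lemma integrable_prod_mul_prod (h : ∀ i j, Integrable (fun x => φ i x * ψ j x) ω)
    (π ρ : Equiv.Perm ι) :
    Integrable (fun x : ι → X => (∏ i, φ (π i) (x i)) * ∏ i, ψ (ρ i) (x i))
      (Measure.pi fun _ => ω) := by
  simp_rw [← Finset.prod_mul_distrib]
  exact Integrable.fintype_prod (μ := fun _ : ι => ω) (f := fun i y => φ (π i) y * ψ (ρ i) y)
    fun i => h _ _

variable [DecidableEq ι]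

lemma integrable_det_mul_det (h : ∀ i j, Integrable (fun x => φ i x * ψ j x) ω) :
    Integrable (fun x : ι → X =>
      (Matrix.of fun i j => φ i (x j)).det * (Matrix.of fun i j => ψ i (x j)).det)
      (Measure.pi fun _ => ω) := by
  simp_rw [det_mul_det_eq_sum]
  exact integrable_finsetSum _ fun π _ => integrable_finsetSum _ fun ρ _ =>
    (integrable_prod_mul_prod ω h π ρ).const_mul _

/-- **Andréief's identity**: `∫ det (φ_i(x_j)) det (ψ_i(x_j)) = n! det (∫ φ_i ψ_j)`. -/
theorem integral_det_mul_det (h : ∀ i j, Integrable (fun x => φ i x * ψ j x) ω) :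
    ∫ x : ι → X, (Matrix.of fun i j => φ i (x j)).det * (Matrix.of fun i j => ψ i (x j)).det
      ∂(Measure.pi fun _ => ω)
      = ((Fintype.card ι).factorial : ℝ) * (Matrix.of fun i j => ∫ x, φ i x * ψ j x ∂ω).det := by
  simp_rw [det_mul_det_eq_sum]
  rw [integral_finsetSum _ fun π _ => integrable_finsetSum _ fun ρ _ =>
    (integrable_prod_mul_prod ω h π ρ).const_mul _]
  simp_rw [integral_finsetSum _ fun ρ _ => (integrable_prod_mul_prod ω h _ ρ).const_mul _,
    integral_const_mul, ← Finset.prod_mul_distrib]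
  rw [Finset.sum_comm]
  -- For fixed `ρ`, the sum over `π` is the Leibniz formula with columns permuted by `ρ`, and the
  -- sign of `ρ` undoes that permutation. Each `ρ` thus contributes equally, whence the factorial.
  have key : ∀ ρ : Equiv.Perm ι, ∑ π : Equiv.Perm ι, ((π.sign : ℤ) : ℝ) * ((ρ.sign : ℤ) : ℝ) *
      ∫ x : ι → X, ∏ i, φ (π i) (x i) * ψ (ρ i) (x i) ∂(Measure.pi fun _ => ω)
      = (Matrix.of fun i j => ∫ x, φ i x * ψ j x ∂ω).det := by
    intro ρ
    have h1 := Matrix.det_permute' ρ (Matrix.of fun i j => ∫ x, φ i x * ψ j x ∂ω)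
    have h2 : ((ρ.sign : ℤ) : ℝ) * ((ρ.sign : ℤ) : ℝ) = 1 := by
      rcases Int.units_eq_one_or ρ.sign with h | h <;> simp [h]
    rw [← one_mul (Matrix.det _), ← h2, mul_assoc, ← h1, Matrix.det_apply', Finset.mul_sum]
    refine Finset.sum_congr rfl fun π _ => ?_
    rw [integral_fintype_prod_eq_prod (μ := fun _ : ι => ω)
      (f := fun i y => φ (π i) y * ψ (ρ i) y)]
    simp only [Matrix.submatrix_apply, Matrix.of_apply, id]
    ring
  rw [Finset.sum_congr rfl fun ρ _ => key ρ, Finset.sum_const, Finset.card_univ,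
    Fintype.card_perm, nsmul_eq_mul]

end Andreief

/-! ### Moments under the DPP density. -/

section Dpp

variable {X : Type*}

/-- The matrix `e_n(x_i)` of the first `N` functions `e` at the nodes. -/
noncomputable def evalMatrix (e : ℕ → X → ℝ) {N : ℕ} (x : Fin N → X) : Matrix (Fin N) (Fin N) ℝ :=
  Matrix.of fun i n => e n (x i)

lemma det_projectionKernel (e : ℕ → X → ℝ) {N : ℕ} (x : Fin N → X) :
    (Matrix.of fun i j : Fin N => projectionKernel e N (x i) (x j)).det
      = (evalMatrix e x).det ^ 2 := by
  have : (Matrix.of fun i j : Fin N => projectionKernel e N (x i) (x j))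
      = evalMatrix e x * (evalMatrix e x).transpose := by
    ext i j
    simp [projectionKernel, Matrix.mul_apply, evalMatrix, Finset.sum_range]
  rw [this, Matrix.det_mul, Matrix.det_transpose, sq]

/-- The index set `{0, …, N - 1}` with `n` replaced by `m`. -/
def replaceIndex {N : ℕ} (n : Fin N) (m : ℕ) (i : Fin N) : ℕ :=
  if i = n then m else i

lemma cramer_evalMatrix (e : ℕ → X → ℝ) {N : ℕ} (x : Fin N → X) (m : ℕ) (n : Fin N) :
    (evalMatrix e x).cramer (fun i => e m (x i)) n
      = (Matrix.of fun i j => e (replaceIndex n m i) (x j)).det := by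
  rw [Matrix.cramer_apply, ← Matrix.det_transpose]
  congr 1
  ext i j
  by_cases h : i = n <;> simp [h, replaceIndex, evalMatrix]

variable [MeasurableSpace X] (ω : Measure X) [IsFiniteMeasure ω] {e : ℕ → X → ℝ}

/-- Since `m ≥ N`, each replaced family is orthonormal, so the Gram matrix is the identity when `n =
n'`. Otherwise `e_{n'}` belongs to the first family and is orthogonal to all of the second, which
makes row `n'` vanish. -/
lemma integral_det_replaceIndex
    (hint : ∀ i j, Integrable (fun x => e i x * e j x) ω)
    (horth : ∀ i j, ∫ x, e i x * e j x ∂ω = if i = j then 1 else 0)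
    {N m : ℕ} (hm : N ≤ m) (n n' : Fin N) :
    ∫ x : Fin N → X, (Matrix.of fun i j => e (replaceIndex n m i) (x j)).det *
      (Matrix.of fun i j => e (replaceIndex n' m i) (x j)).det ∂(Measure.pi fun _ => ω)
      = (N.factorial : ℝ) * if n = n' then 1 else 0 := by
  rw [integral_det_mul_det ω fun i j => hint _ _, Fintype.card_fin]
  congr 1
  simp_rw [horth]
  have hN : ∀ i : Fin N, (i : ℕ) ≠ m := fun i => by have := i.2; omega
  have hN' : ∀ i : Fin N, m ≠ (i : ℕ) := fun i => (hN i).symm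
  split_ifs with h
  · subst h
    convert Matrix.det_one (n := Fin N) (R := ℝ) using 2
    ext i j
    by_cases hi : i = n <;> by_cases hj : j = n <;>
      simp [replaceIndex, hi, hj, Matrix.one_apply, hN, hN', Fin.val_inj, eq_comm (a := n)]
  · refine Matrix.det_eq_zero_of_row_eq_zero n' fun j => ?_
    have h' : n' ≠ n := Ne.symm h
    by_cases hj : j = n'
    · simp [replaceIndex, hj, h', hN]
    · by_cases hj' : j = n <;>
        simp [replaceIndex, hj, hj', h, h', Fin.val_inj, Ne.symm hj]

lemma integral_sq_det_evalMatrix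
    (hint : ∀ i j, Integrable (fun x => e i x * e j x) ω)
    (horth : ∀ i j, ∫ x, e i x * e j x ∂ω = if i = j then 1 else 0) (N : ℕ) :
    Integrable (fun x : Fin N → X => (evalMatrix e x).det ^ 2) (Measure.pi fun _ => ω) ∧
    ∫ x : Fin N → X, (evalMatrix e x).det ^ 2 ∂(Measure.pi fun _ => ω) = N.factorial := by
  have h : ∀ x : Fin N → X, (evalMatrix e x).det ^ 2
      = (Matrix.of fun i j : Fin N => e i (x j)).det *
        (Matrix.of fun i j : Fin N => e i (x j)).det := fun x => by
    rw [sq, ← Matrix.det_transpose]; rfl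
  simp_rw [h]
  refine ⟨integrable_det_mul_det ω fun i j => hint _ _, ?_⟩
  rw [integral_det_mul_det ω fun i j => hint _ _, Fintype.card_fin]
  simp_rw [horth, Fin.val_inj]
  have : (Matrix.of fun i j : Fin N => if i = j then (1 : ℝ) else 0) = 1 := by
    ext i j; simp [Matrix.one_apply]
  rw [this, Matrix.det_one, mul_one]

lemma integral_sq_sum_cramer
    (hint : ∀ i j, Integrable (fun x => e i x * e j x) ω)
    (horth : ∀ i j, ∫ x, e i x * e j x ∂ω = if i = j then 1 else 0)
    {N m : ℕ} (hm : N ≤ m) (v : Fin N → ℝ) :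
    Integrable (fun x : Fin N → X =>
      (∑ n, v n * (evalMatrix e x).cramer (fun i => e m (x i)) n) ^ 2)
      (Measure.pi fun _ => ω) ∧
    ∫ x : Fin N → X, (∑ n, v n * (evalMatrix e x).cramer (fun i => e m (x i)) n) ^ 2
      ∂(Measure.pi fun _ => ω) = N.factorial * ∑ n, v n ^ 2 := by
  have h : ∀ x : Fin N → X, (∑ n, v n * (evalMatrix e x).cramer (fun i => e m (x i)) n) ^ 2
      = ∑ n, ∑ n', v n * v n' * ((Matrix.of fun i j => e (replaceIndex n m i) (x j)).det *
        (Matrix.of fun i j => e (replaceIndex n' m i) (x j)).det) := by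
    intro x
    rw [sq, Finset.sum_mul_sum]
    simp_rw [cramer_evalMatrix]
    exact Finset.sum_congr rfl fun _ _ => Finset.sum_congr rfl fun _ _ => by ring
  have hI : ∀ n n' : Fin N, Integrable (fun x : Fin N → X => v n * v n' *
      ((Matrix.of fun i j => e (replaceIndex n m i) (x j)).det *
        (Matrix.of fun i j => e (replaceIndex n' m i) (x j)).det)) (Measure.pi fun _ => ω) :=
    fun n n' => (integrable_det_mul_det ω fun i j => hint _ _).const_mul _
  simp_rw [h]
  refine ⟨integrable_finsetSum _ fun n _ => integrable_finsetSum _ fun n' _ => hI n n', ?_⟩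
  rw [integral_finsetSum _ fun n _ => integrable_finsetSum _ fun n' _ => hI n n']
  simp_rw [integral_finsetSum _ fun n' _ => hI _ n', integral_const_mul,
    integral_det_replaceIndex ω hint horth hm]
  rw [Finset.mul_sum]
  refine Finset.sum_congr rfl fun n _ => ?_
  simp
  ring

lemma measurable_det_evalMatrix (he : ∀ m, Measurable (e m)) (N : ℕ) :
    Measurable fun x : Fin N → X => (evalMatrix e x).det := by
  simp_rw [Matrix.det_apply']
  refine Finset.measurable_sum _ fun π _ => Measurable.const_mul ?_ _
  exact Finset.measurable_prod _ fun i _ => (he _).comp (measurable_pi_apply _)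

lemma isProbabilityMeasure_dppLaw
    (hint : ∀ i j, Integrable (fun x => e i x * e j x) ω)
    (horth : ∀ i j, ∫ x, e i x * e j x ∂ω = if i = j then 1 else 0) (N : ℕ) :
    IsProbabilityMeasure (dppLaw ω e N) := by
  obtain ⟨h1, h2⟩ := integral_sq_det_evalMatrix ω hint horth N
  constructor
  rw [dppLaw, withDensity_apply _ MeasurableSet.univ, Measure.restrict_univ]
  simp_rw [det_projectionKernel]
  rw [← ofReal_integral_eq_lintegral_ofReal (h1.const_mul _)
    (Eventually.of_forall fun x => by positivity), integral_const_mul, h2]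
  have : (N.factorial : ℝ) ≠ 0 := by positivity
  simp [this]

end Dpp

end DPPSampling

namespace DPPSampling

/-! ### Orthogonal projections and Hilbert bases. -/

section Hilbert

variable {E : Type*} [NormedAddCommGroup E] [InnerProductSpace ℝ E]

lemma separableSpace_of_hilbertBasis {ι : Type*} [Countable ι] (b : HilbertBasis ι ℝ E) :
    TopologicalSpace.SeparableSpace E := by
  rw [← TopologicalSpace.isSeparable_univ_iff]
  have h := ((Set.countable_range b).isSeparable.span (R := ℝ)).closure
  have h' := congrArg (fun S : Submodule ℝ E => (S : Set E)) b.dense_span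
  rw [Submodule.topologicalClosure_coe] at h'
  rwa [h'] at h

lemma tsum_ofReal_inner_sq {ι : Type*} (b : HilbertBasis ι ℝ E) (v : E) :
    ∑' m, ENNReal.ofReal (⟪b m, v⟫_ℝ ^ 2) = ENNReal.ofReal (‖v‖ ^ 2) := by
  have h := b.hasSum_inner_mul_inner v v
  have h' : ∀ m, ⟪v, b m⟫_ℝ * ⟪b m, v⟫_ℝ = ⟪b m, v⟫_ℝ ^ 2 := fun m => by
    rw [real_inner_comm, sq]
  simp_rw [h', real_inner_self_eq_norm_sq] at h
  rw [← h.tsum_eq, ENNReal.ofReal_tsum_of_nonneg (fun m => sq_nonneg _) h.summable]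

lemma norm_sub_starProjection_le (K : Submodule ℝ E) [K.HasOrthogonalProjection] (f : E) {y : E}
    (hy : y ∈ K) : ‖f - K.starProjection f‖ ≤ ‖f - y‖ := by
  rw [K.starProjection_minimal f]
  exact ciInf_le ⟨0, by rintro _ ⟨z, rfl⟩; positivity⟩ (⟨y, hy⟩ : K)

lemma norm_sub_starProjection_le_norm (K : Submodule ℝ E) [K.HasOrthogonalProjection] (f : E) :
    ‖f - K.starProjection f‖ ≤ ‖f‖ := by
  simpa using norm_sub_starProjection_le K f K.zero_mem

/-- Rational coefficients suffice by density, so sublevel sets of the distance become countable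
unions; this gives measurability in the nodes. -/
lemma norm_sub_starProjection_lt_iff {ι : Type*} [Fintype ι] (K : Submodule ℝ E)
    [K.HasOrthogonalProjection] {t : ι → E} (hK : K = Submodule.span ℝ (Set.range t)) (f : E)
    (a : ℝ) : ‖f - K.starProjection f‖ < a ↔ ∃ c : ι → ℚ, ‖f - ∑ i, (c i : ℝ) • t i‖ < a := by
  constructor
  · intro h
    have hP : K.starProjection f ∈ Submodule.span ℝ (Set.range t) :=
      hK ▸ K.starProjection_apply_mem f
    obtain ⟨c, hc⟩ := (Submodule.mem_span_range_iff_exists_fun ℝ).1 hP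
    rw [← hc] at h
    have hopen : IsOpen {d : ι → ℝ | ‖f - ∑ i, d i • t i‖ < a} :=
      isOpen_lt (by fun_prop) continuous_const
    have hd : DenseRange (fun (c : ι → ℚ) (i : ι) => (c i : ℝ)) :=
      DenseRange.piMap fun _ => Rat.denseRange_cast
    exact hd.exists_mem_open hopen ⟨c, h⟩
  · rintro ⟨c, hc⟩
    refine (norm_sub_starProjection_le K f ?_).trans_lt hc
    rw [hK]
    exact Submodule.sum_mem _ fun i _ =>
      Submodule.smul_mem _ _ (Submodule.subset_span ⟨i, rfl⟩)

lemma norm_sub_starProjection_sq_le (K : Submodule ℝ E) [K.HasOrthogonalProjection] (f g : E) :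
    ‖f - K.starProjection f‖ ^ 2 ≤ 2 * ‖g - K.starProjection g‖ ^ 2 + 2 * ‖f - g‖ ^ 2 := by
  have h1 : ‖f - K.starProjection f‖ ≤ ‖g - K.starProjection g‖ + ‖f - g‖ := by
    refine (norm_sub_starProjection_le K f (K.starProjection_apply_mem g)).trans ?_
    rw [add_comm]
    exact norm_sub_le_norm_sub_add_norm_sub f g _
  have h2 := norm_nonneg (f - K.starProjection f)
  nlinarith [sq_nonneg (‖g - K.starProjection g‖ - ‖f - g‖)]

end Hilbert

variable {X : Type*} [MetricSpace X] [MeasurableSpace X] [BorelSpace X] {k : X → X → ℝ}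

lemma inner_kernelTranslate (hk : IsAdmissibleKernel k) (ω : Measure X)
    [IsFiniteMeasure ω] (g : Lp ℝ 2 ω) (x : X) :
    ⟪g, kernelTranslate hk ω x⟫_ℝ = integralOperator k ω g x := by
  rw [L2.inner_def, integralOperator]
  refine integral_congr_ae ?_
  filter_upwards [(hk.memLp ω x).coeFn_toLp] with y hy
  rw [kernelTranslate, hy]
  simp

/-! ### The RKHS inside `L²(ω)`. -/

section Inclusion

variable {H : Type*} [NormedAddCommGroup H] [InnerProductSpace ℝ H] [CompleteSpace H]
  [RKHS ℝ H X ℝ]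

/-- The inclusion of the RKHS of an admissible kernel into `L²(ω)`. -/
noncomputable def inclusionL2 (hH : HasKernel H k) (hk : IsAdmissibleKernel k) (ω : Measure X)
    [IsFiniteMeasure ω] : H →L[ℝ] Lp ℝ 2 ω :=
  LinearMap.mkContinuousOfExistsBound
    { toFun := fun f => (hH.memLp hk ω f).toLp
      map_add' := fun f g => by
        rw [← MemLp.toLp_add]; congr 1; ext x; simp
      map_smul' := fun c f => by
        rw [RingHom.id_apply, ← MemLp.toLp_const_smul]; congr 1; ext x; simp } (by
    obtain ⟨C, hC⟩ := hk.bounded_diag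
    refine ⟨(measureUnivNNReal ω : ℝ) ^ (2 : ENNReal).toReal⁻¹ * √C, fun f => ?_⟩
    have hb : ∀ x, ‖f x‖ ≤ √C * ‖f‖ := fun x => by
      rw [HasKernel.apply_eq f x]
      refine (norm_inner_le_norm _ _).trans ?_
      gcongr
      rw [← Real.sqrt_sq (norm_nonneg (RKHS.kerFun H x (1 : ℝ))), ← real_inner_self_eq_norm_sq,
        hH.inner_kerFun]
      exact Real.sqrt_le_sqrt (hC x)
    rw [mul_assoc]
    refine Lp.norm_le_of_ae_bound (by positivity) ?_
    filter_upwards [(hH.memLp hk ω f).coeFn_toLp] with x hx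
    exact (congrArg norm hx).trans_le (hb x))

variable (hH : HasKernel H k) (hk : IsAdmissibleKernel k) (ω : Measure X) [IsFiniteMeasure ω]

lemma inclusionL2_apply (f : H) : inclusionL2 hH hk ω f = (hH.memLp hk ω f).toLp := rfl

lemma inclusionL2_kerFun (x : X) :
    inclusionL2 hH hk ω (RKHS.kerFun H x (1 : ℝ)) = kernelTranslate hk ω x := by
  rw [inclusionL2_apply, kernelTranslate]
  congr 1
  ext y
  rw [RKHS.kerFun_apply, hH y x]
  exact hk.posSemidef.isHermitian.apply x y

lemma measurable_kernelTranslate (hH : HasKernel H k) [MeasurableSpace (Lp ℝ 2 ω)] [BorelSpace (Lp ℝ 2 ω)] :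
    Measurable fun x : X => kernelTranslate hk ω x := by
  simp_rw [← inclusionL2_kerFun hH hk ω]
  exact ((inclusionL2 hH hk ω).continuous.comp (hH.continuous_kerFun hk)).measurable

/-- With `J` the inclusion, this makes `J J*` the integral operator on `L²(ω)`. -/
lemma inclusionL2_adjoint_apply (g : Lp ℝ 2 ω) (x : X) :
    (inclusionL2 hH hk ω).adjoint g x = integralOperator k ω g x := by
  rw [HasKernel.apply_eq, ContinuousLinearMap.adjoint_inner_right, inclusionL2_kerFun,
    real_inner_comm, inner_kernelTranslate]

variable {σ : ℕ → ℝ} {b : HilbertBasis ℕ ℝ (Lp ℝ 2 ω)} {e : ℕ → X → ℝ}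

lemma inclusionL2_adjoint_basis (hσe : IsEigensystem k ω σ b e) (m : ℕ) :
    inclusionL2 hH hk ω ((inclusionL2 hH hk ω).adjoint (b m)) = σ m • b m := by
  apply Lp.ext
  rw [inclusionL2_apply]
  filter_upwards [MemLp.coeFn_toLp (hH.memLp hk ω ((inclusionL2 hH hk ω).adjoint (b m))),
    hσe.eigen m, Lp.coeFn_smul (σ m) (b m)] with x h1 h2 h3
  rw [h1, h3, inclusionL2_adjoint_apply, h2]
  rfl

/-- The coefficients of an element of the RKHS in an eigenbasis satisfy
`∑ ⟨b_m, f⟩² / σ_m ≤ ‖f‖²`. -/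
lemma sum_sq_inner_div_le (hσe : IsEigensystem k ω σ b e) (f : H) (S : Finset ℕ) :
    ∑ m ∈ S, ⟪b m, inclusionL2 hH hk ω f⟫_ℝ ^ 2 / σ m ≤ ‖f‖ ^ 2 := by
  set J := inclusionL2 hH hk ω
  -- `⟨J* b_i, J* b_j⟩ = ⟨b_i, J J* b_j⟩ = σ_j δ_ij`; the claim is then Bessel's inequality in the
  -- RKHS.
  have hu : Orthonormal ℝ fun m => (√(σ m))⁻¹ • J.adjoint (b m) := by
    rw [orthonormal_iff_ite]
    intro i j
    rw [real_inner_smul_left, real_inner_smul_right, ContinuousLinearMap.adjoint_inner_left,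
      inclusionL2_adjoint_basis hH hk ω hσe, real_inner_smul_right,
      orthonormal_iff_ite.1 b.orthonormal]
    split_ifs with h
    · subst h
      have h1 := Real.sqrt_pos.2 (hσe.pos i)
      have h2 := Real.sq_sqrt (hσe.pos i).le
      field_simp
      linarith
    · simp
  refine le_trans (le_of_eq (Finset.sum_congr rfl fun m _ => ?_))
    (hu.sum_inner_products_le f (s := S))
  rw [real_inner_smul_left, ContinuousLinearMap.adjoint_inner_left, Real.norm_eq_abs, sq_abs,
    mul_pow, inv_pow, Real.sq_sqrt (hσe.pos m).le]
  ring

end Inclusion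

end DPPSampling

/-! ### The error for targets spanned by the first `N` eigenfunctions. -/

namespace DPPSampling

variable {X : Type*} [MetricSpace X] [MeasurableSpace X] {k : X → X → ℝ}
  {ω : Measure X}
  {σ : ℕ → ℝ} {b : HilbertBasis ℕ ℝ (Lp ℝ 2 ω)} {e : ℕ → X → ℝ}

lemma IsEigensystem.integrable_mul (hσe : IsEigensystem k ω σ b e) (i j : ℕ) :
    Integrable (fun x => e i x * e j x) ω := by
  refine (L2.integrable_inner (𝕜 := ℝ) (b i) (b j)).congr ?_
  filter_upwards [hσe.ae_eq i, hσe.ae_eq j] with x hi hj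
  simp [hi, hj, mul_comm]

lemma IsEigensystem.integral_mul (hσe : IsEigensystem k ω σ b e) (i j : ℕ) :
    ∫ x, e i x * e j x ∂ω = if i = j then 1 else 0 := by
  rw [← orthonormal_iff_ite.1 b.orthonormal i j, L2.inner_def]
  refine integral_congr_ae ?_
  filter_upwards [hσe.ae_eq i, hσe.ae_eq j] with x hi hj
  simp [hi, hj, mul_comm]

variable [IsFiniteMeasure ω]

lemma IsEigensystem.isProbabilityMeasure_dppLaw (hσe : IsEigensystem k ω σ b e) (N : ℕ) :
    IsProbabilityMeasure (dppLaw ω e N) :=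
  DPPSampling.isProbabilityMeasure_dppLaw ω hσe.integrable_mul hσe.integral_mul N

variable [BorelSpace X] (hk : IsAdmissibleKernel k)

lemma IsEigensystem.ae_inner_kernelTranslate (hσe : IsEigensystem k ω σ b e) (N : ℕ) :
    ∀ᵐ x ∂(Measure.pi fun _ : Fin N => ω), ∀ (i : Fin N) (m : ℕ),
      ⟪b m, kernelTranslate hk ω (x i)⟫_ℝ = σ m * e m (x i) := by
  rw [ae_all_iff]
  intro i
  have h : ∀ᵐ y ∂ω, ∀ m : ℕ, ⟪b m, kernelTranslate hk ω y⟫_ℝ = σ m * e m y := by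
    rw [ae_all_iff]
    intro m
    filter_upwards [hσe.eigen m, hσe.ae_eq m] with y h1 h2
    rw [inner_kernelTranslate, h1, h2]
  exact (Measure.quasiMeasurePreserving_eval (fun _ : Fin N => ω) i).ae h

/-- Cramer's rule for the approximation of `∑ σ_n v_n b_n` by the kernel translates that matches
the first `N` coefficients. -/
lemma ofReal_det_sq_mul_norm_sub_le {N : ℕ} {x : Fin N → X}
    (hx : ∀ (i : Fin N) (m : ℕ), ⟪b m, kernelTranslate hk ω (x i)⟫_ℝ = σ m * e m (x i))
    (v : Fin N → ℝ) :
    ENNReal.ofReal ((evalMatrix e x).det ^ 2 *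
      ‖(∑ n : Fin N, (σ n * v n) • b n) - lsApprox hk ω x (∑ n : Fin N, (σ n * v n) • b n)‖ ^ 2)
    ≤ ∑' j : ℕ, ENNReal.ofReal (σ (j + N) ^ 2) * ENNReal.ofReal
      ((∑ n, v n * (evalMatrix e x).cramer (fun i => e (j + N) (x i)) n) ^ 2) := by
  set g : Lp ℝ 2 ω := ∑ n : Fin N, (σ n * v n) • b n with hg
  set A := evalMatrix e x with hA
  -- Degenerate node sets cost nothing: the weight `(det A)²` vanishes there.
  rcases eq_or_ne A.det 0 with h0 | h0
  · simp [h0]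
  obtain ⟨c, hc⟩ : ∃ c, A.transpose.mulVec c = v :=
    ⟨A.transpose⁻¹.mulVec v, by
      rw [Matrix.mulVec_mulVec, Matrix.mul_nonsing_inv _ (by simpa using h0), Matrix.one_mulVec]⟩
  have hc' : ∀ n : Fin N, ∑ i, c i * e n (x i) = v n := fun n => by
    rw [← hc]
    simp [Matrix.mulVec, dotProduct, hA, evalMatrix, mul_comm]
  set y : Lp ℝ 2 ω := ∑ i, c i • kernelTranslate hk ω (x i) with hy
  have hmem : y ∈ kernelSpan hk ω x := Submodule.sum_mem _ fun i _ =>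
    Submodule.smul_mem _ _ (Submodule.subset_span ⟨i, rfl⟩)
  have hle : ‖g - lsApprox hk ω x g‖ ^ 2 ≤ ‖g - y‖ ^ 2 := by
    gcongr
    exact norm_sub_starProjection_le _ g hmem
  have hyb : ∀ m, ⟪b m, y⟫_ℝ = σ m * ∑ i, c i * e m (x i) := fun m => by
    rw [hy, inner_sum, Finset.mul_sum]
    refine Finset.sum_congr rfl fun i _ => ?_
    rw [real_inner_smul_right, hx]
    ring
  have hgb : ∀ m, ⟪b m, g⟫_ℝ = ∑ n : Fin N, if m = n then σ n * v n else 0 := fun m => by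
    rw [hg, inner_sum]
    refine Finset.sum_congr rfl fun n _ => ?_
    rw [real_inner_smul_right, orthonormal_iff_ite.1 b.orthonormal]
    simp
  have hlow : ∀ m ∈ Finset.range N, ENNReal.ofReal (⟪b m, g - y⟫_ℝ ^ 2) = 0 := fun m hm => by
    have hm' := Finset.mem_range.1 hm
    have h1 : ⟪b m, g⟫_ℝ = σ m * v ⟨m, hm'⟩ := by
      rw [hgb, Finset.sum_eq_single ⟨m, hm'⟩]
      · simp
      · intro n _ hn
        rw [if_neg]
        rintro rfl
        exact hn rfl
      · simp
    rw [inner_sub_right, h1, hyb, hc' ⟨m, hm'⟩]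
    simp
  have hhigh : ∀ j, A.det ^ 2 * ⟪b (j + N), g - y⟫_ℝ ^ 2 = σ (j + N) ^ 2 *
      (∑ n, v n * A.cramer (fun i => e (j + N) (x i)) n) ^ 2 := fun j => by
    have h1 : ⟪b (j + N), g⟫_ℝ = 0 := by
      rw [hgb]
      refine Finset.sum_eq_zero fun n _ => if_neg ?_
      have := n.2
      omega
    have h2 : ∑ n, v n * A.cramer (fun i => e (j + N) (x i)) n
        = A.det * ∑ i, c i * e (j + N) (x i) := by
      -- Moving `A` across the pairing through `v = Aᵀ c` avoids inverting `A`.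
      have h3 : v ⬝ᵥ A.cramer (fun i => e (j + N) (x i))
          = c ⬝ᵥ A.mulVec (A.cramer fun i => e (j + N) (x i)) := by
        rw [Matrix.dotProduct_mulVec, ← hc, Matrix.mulVec_transpose]
      rw [Matrix.mulVec_cramer, dotProduct_smul] at h3
      exact h3
    rw [inner_sub_right, h1, hyb, h2]
    ring
  calc ENNReal.ofReal (A.det ^ 2 * ‖g - lsApprox hk ω x g‖ ^ 2)
      ≤ ENNReal.ofReal (A.det ^ 2 * ‖g - y‖ ^ 2) := by gcongr
    _ = ENNReal.ofReal (A.det ^ 2) * ∑' j, ENNReal.ofReal (⟪b (j + N), g - y⟫_ℝ ^ 2) := by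
      rw [ENNReal.ofReal_mul (sq_nonneg _), ← tsum_ofReal_inner_sq b,
        ← ENNReal.summable.sum_add_tsum_nat_add' (k := N), Finset.sum_eq_zero hlow, zero_add]
    _ = _ := by
      rw [← ENNReal.tsum_mul_left]
      refine tsum_congr fun j => ?_
      rw [← ENNReal.ofReal_mul (sq_nonneg _), hhigh, ENNReal.ofReal_mul (sq_nonneg _)]

lemma IsEigensystem.lintegral_norm_sub_lsApprox_le (hσe : IsEigensystem k ω σ b e) {N : ℕ}
    (v : Fin N → ℝ) :
    ∫⁻ x, ENNReal.ofReal
      (‖(∑ n : Fin N, (σ n * v n) • b n) - lsApprox hk ω x (∑ n : Fin N, (σ n * v n) • b n)‖ ^ 2)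
      ∂(dppLaw ω e N)
    ≤ (∑' j : ℕ, ENNReal.ofReal (σ (j + N) ^ 2)) * ENNReal.ofReal (∑ n, v n ^ 2) := by
  set g : Lp ℝ 2 ω := ∑ n : Fin N, (σ n * v n) • b n with hg
  have hf : (0 : ℝ) < N.factorial := by positivity
  have hem : ∀ m, Measurable (e m) := fun m => (hσe.continuous m).measurable
  rw [dppLaw]
  simp_rw [det_projectionKernel]
  -- This inequality requires measurability of the density only, not of the error.
  refine (lintegral_withDensity_le_lintegral_mul _
    (((measurable_det_evalMatrix hem N).pow_const 2).const_mul _).ennreal_ofReal _).trans ?_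
  simp only [Pi.mul_apply]
  have hI := fun j : ℕ => integral_sq_sum_cramer ω hσe.integrable_mul hσe.integral_mul
    (Nat.le_add_left N j) v
  calc _ ≤ ∫⁻ x : Fin N → X, ∑' j : ℕ, ENNReal.ofReal (1 / (N.factorial : ℝ) * σ (j + N) ^ 2) *
          ENNReal.ofReal ((∑ n, v n * (evalMatrix e x).cramer (fun i => e (j + N) (x i)) n) ^ 2)
          ∂(Measure.pi fun _ => ω) := by
        refine lintegral_mono_ae ?_
        filter_upwards [hσe.ae_inner_kernelTranslate hk N] with x hx
        have h := ofReal_det_sq_mul_norm_sub_le hk hx v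
        rw [ENNReal.ofReal_mul (by positivity), mul_assoc, ← ENNReal.ofReal_mul (sq_nonneg _)]
        refine (mul_le_mul_right h _).trans_eq ?_
        rw [← ENNReal.tsum_mul_left]
        refine tsum_congr fun j => ?_
        rw [ENNReal.ofReal_mul (p := 1 / (N.factorial : ℝ)) (by positivity), mul_assoc]
    _ = ∑' j : ℕ, ENNReal.ofReal (1 / (N.factorial : ℝ) * σ (j + N) ^ 2) *
          ENNReal.ofReal (N.factorial * ∑ n, v n ^ 2) := by
        rw [lintegral_tsum fun j => ((hI j).1.aemeasurable.ennreal_ofReal).const_mul _]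
        refine tsum_congr fun j => ?_
        rw [lintegral_const_mul'' _ (hI j).1.aemeasurable.ennreal_ofReal,
          ← ofReal_integral_eq_lintegral_ofReal (hI j).1
            (Eventually.of_forall fun x => sq_nonneg _), (hI j).2]
    _ = _ := by
        rw [← ENNReal.tsum_mul_right]
        refine tsum_congr fun j => ?_
        rw [← ENNReal.ofReal_mul (by positivity), ← ENNReal.ofReal_mul (by positivity)]
        congr 1
        field_simp

/-! ### Measurability of the error in the nodes. -/

section Measurability

variable {H : Type*} [NormedAddCommGroup H] [InnerProductSpace ℝ H] [CompleteSpace H]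
  [RKHS ℝ H X ℝ]

lemma measurable_norm_sub_lsApprox (hH : HasKernel H k) (b : HilbertBasis ℕ ℝ (Lp ℝ 2 ω))
    (f : Lp ℝ 2 ω) (N : ℕ) :
    Measurable fun x : Fin N → X => ‖f - lsApprox hk ω x f‖ := by
  have := separableSpace_of_hilbertBasis b
  have := UniformSpace.secondCountable_of_separable (Lp ℝ 2 ω)
  borelize ↥(Lp ℝ 2 ω)
  refine measurable_of_Iio fun a => ?_
  have h : (fun x : Fin N → X => ‖f - lsApprox hk ω x f‖) ⁻¹' Set.Iio a
      = ⋃ c : Fin N → ℚ, {x | ‖f - ∑ i, (c i : ℝ) • kernelTranslate hk ω (x i)‖ < a} := by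
    ext x
    simp only [Set.mem_preimage, Set.mem_Iio, Set.mem_iUnion, Set.mem_ofPred_eq]
    exact norm_sub_starProjection_lt_iff (kernelSpan hk ω x) rfl f a
  rw [h]
  refine MeasurableSet.iUnion fun c => measurableSet_lt ?_ measurable_const
  refine (measurable_const.sub (Finset.measurable_sum _ fun i _ => ?_)).norm
  have hT := measurable_kernelTranslate hk ω hH
  have hTi : Measurable fun x : Fin N → X => kernelTranslate hk ω (x i) :=
    hT.comp (measurable_pi_apply i)
  exact hTi.const_smul (c i : ℝ)

lemma integrable_norm_sub_lsApprox_sq (hH : HasKernel H k) (b : HilbertBasis ℕ ℝ (Lp ℝ 2 ω))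
    (f : Lp ℝ 2 ω) {N : ℕ} (μ : Measure (Fin N → X)) [IsFiniteMeasure μ] :
    Integrable (fun x => ‖f - lsApprox hk ω x f‖ ^ 2) μ := by
  refine Integrable.of_bound
    ((measurable_norm_sub_lsApprox hk hH b f N).pow_const 2).aestronglyMeasurable
    (‖f‖ ^ 2) (Eventually.of_forall fun x => ?_)
  rw [Real.norm_of_nonneg (by positivity)]
  gcongr
  exact norm_sub_starProjection_le_norm _ f

end Measurability

end DPPSampling

/-! ### Eigenvalue tails, truncation and the rate. -/

namespace DPPSampling

/-- Equivalent to `1 + 1/x ≤ (1 + 1/x)^(p - 1)`, true as `p - 1 ≥ 1`. The right side telescopes,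
bounding the tail with constant `1`. -/
lemma rpow_neg_le_sub {x p : ℝ} (hx : 0 < x) (hp : 2 ≤ p) :
    (x + 1) ^ (-p) ≤ x ^ (1 - p) - (x + 1) ^ (1 - p) := by
  have hx1 : 0 < x + 1 := by linarith
  have h1 : x + 1 ≤ (x + 1) ^ (p - 1) / x ^ (p - 1) * x := by
    rw [← Real.div_rpow hx1.le hx.le, ← div_le_iff₀ hx]
    exact Real.self_le_rpow_of_one_le (by rw [le_div_iff₀ hx]; linarith) (by linarith)
  have hA : 0 < x ^ (p - 1) := Real.rpow_pos_of_pos hx _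
  have hB : 0 < (x + 1) ^ (p - 1) := Real.rpow_pos_of_pos hx1 _
  have e1 : (x + 1) ^ (-p) = ((x + 1) ^ (p - 1))⁻¹ * (x + 1)⁻¹ := by
    rw [← Real.rpow_neg hx1.le, ← Real.rpow_neg_one (x + 1), ← Real.rpow_add hx1]
    congr 1; ring
  have e2 : ∀ y : ℝ, 0 < y → y ^ (1 - p) = (y ^ (p - 1))⁻¹ := fun y hy => by
    rw [← Real.rpow_neg hy.le]; congr 1; ring
  rw [e1, e2 _ hx, e2 _ hx1]
  set A := x ^ (p - 1)
  set B := (x + 1) ^ (p - 1)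
  have h2 : A * (x + 1) ≤ B * x := by
    have := mul_le_mul_of_nonneg_left h1 hA.le
    rwa [show A * (B / A * x) = B * x by field_simp] at this
  rw [le_sub_iff_add_le, ← mul_add_one, inv_mul_le_iff₀ hB, ← div_eq_mul_inv, le_div_iff₀ hA]
  rw [add_mul, inv_mul_eq_div, one_mul, div_add' _ _ _ hx1.ne', div_le_iff₀ hx1]
  nlinarith

lemma tsum_ofReal_rpow_le {p : ℝ} (hp : 2 ≤ p) {N : ℕ} (hN : 1 ≤ N) :
    ∑' j : ℕ, ENNReal.ofReal ((((j + N : ℕ) : ℝ) + 1) ^ (-p)) ≤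
      ENNReal.ofReal ((N : ℝ) ^ (1 - p)) := by
  refine ENNReal.tsum_le_of_sum_range_le fun M => ?_
  rw [← ENNReal.ofReal_sum_of_nonneg fun j _ => by positivity]
  refine ENNReal.ofReal_le_ofReal ?_
  have key : ∑ j ∈ Finset.range M, (((j + N : ℕ) : ℝ) + 1) ^ (-p)
      ≤ (N : ℝ) ^ (1 - p) - ((M + N : ℕ) : ℝ) ^ (1 - p) := by
    induction M with
    | zero => simp
    | succ M ih =>
      rw [Finset.sum_range_succ]
      have h0 : (0 : ℝ) < ((M + N : ℕ) : ℝ) := by exact_mod_cast (by omega)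
      have h := rpow_neg_le_sub h0 hp
      have h1 : ((M + 1 + N : ℕ) : ℝ) = ((M + N : ℕ) : ℝ) + 1 := by push_cast; ring
      rw [h1]
      linarith
  have : (0 : ℝ) ≤ ((M + N : ℕ) : ℝ) ^ (1 - p) := by positivity
  linarith

variable {X : Type*} [MetricSpace X] [MeasurableSpace X] [BorelSpace X] {k : X → X → ℝ}
  (hk : IsAdmissibleKernel k) {ω : Measure X} [IsFiniteMeasure ω]
  {σ : ℕ → ℝ} {b : HilbertBasis ℕ ℝ (Lp ℝ 2 ω)} {e : ℕ → X → ℝ}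
  {H : Type*} [NormedAddCommGroup H] [InnerProductSpace ℝ H] [CompleteSpace H]
  [RKHS ℝ H X ℝ]

/-- The expected squared error, by truncating the target at the eigenvalue level `τ`. -/
lemma IsEigensystem.lintegral_norm_sub_lsApprox_rkhs_le (hσe : IsEigensystem k ω σ b e)
    (hH : HasKernel H k) (f : H) {N : ℕ} {τ : ℝ} (hτ : 0 < τ) (hN : σ N ≤ τ) :
    ∫⁻ x, ENNReal.ofReal
      (‖inclusionL2 hH hk ω f - lsApprox hk ω x (inclusionL2 hH hk ω f)‖ ^ 2) ∂(dppLaw ω e N)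
    ≤ 2 * ((∑' j : ℕ, ENNReal.ofReal (σ (j + N) ^ 2)) * ENNReal.ofReal (‖f‖ ^ 2 / τ)) +
      2 * ENNReal.ofReal (τ * ‖f‖ ^ 2) := by
  have := hσe.isProbabilityMeasure_dppLaw N
  set F := inclusionL2 hH hk ω f with hF
  -- The cutoff is what bounds `∑ v_n²`: `1 / σ_n² ≤ 1 / (τ σ_n)` on the retained indices.
  set v : Fin N → ℝ := fun n => if τ ≤ σ n then ⟪b n, F⟫_ℝ / σ n else 0 with hv
  set g : Lp ℝ 2 ω := ∑ n : Fin N, (σ n * v n) • b n with hg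
  have hbessel := sum_sq_inner_div_le hH hk ω hσe f
  have hv2 : ∑ n, v n ^ 2 ≤ ‖f‖ ^ 2 / τ := by
    rw [le_div_iff₀ hτ]
    refine le_trans ?_ (hbessel (Finset.range N))
    rw [Finset.sum_range, Finset.sum_mul]
    refine Finset.sum_le_sum fun n _ => ?_
    have hp := hσe.pos n
    simp only [hv]
    split_ifs with h
    · rw [div_pow, sq (σ n), ← div_div, div_mul_eq_mul_div, div_le_iff₀ hp]
      gcongr
    · rw [zero_pow two_ne_zero, zero_mul]
      positivity
  have hcoef : ∀ m, ⟪b m, F - g⟫_ℝ ^ 2 ≤ τ * (⟪b m, F⟫_ℝ ^ 2 / σ m) := fun m => by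
    have hgb : ⟪b m, g⟫_ℝ = ∑ n : Fin N, if m = n then σ n * v n else 0 := by
      rw [hg, inner_sum]
      refine Finset.sum_congr rfl fun n _ => ?_
      rw [real_inner_smul_right, orthonormal_iff_ite.1 b.orthonormal]
      simp
    have hp := hσe.pos m
    have hsmall : σ m ≤ τ → ⟪b m, F⟫_ℝ ^ 2 ≤ τ * (⟪b m, F⟫_ℝ ^ 2 / σ m) := fun h => by
      rw [mul_div_left_comm]
      exact le_mul_of_one_le_right (sq_nonneg _) ((one_le_div₀ hp).2 h)
    rw [inner_sub_right]
    rcases lt_or_ge m N with hm | hm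
    · have h1 : ⟪b m, g⟫_ℝ = σ m * v ⟨m, hm⟩ := by
        rw [hgb, Finset.sum_eq_single ⟨m, hm⟩]
        · simp
        · intro n _ hn
          rw [if_neg]
          rintro rfl
          exact hn rfl
        · simp
      rw [h1]
      simp only [hv]
      split_ifs with h
      · rw [mul_div_cancel₀ _ hp.ne', sub_self, zero_pow two_ne_zero]
        positivity
      · rw [mul_zero, sub_zero]
        exact hsmall (not_le.1 h).le
    · have h1 : ⟪b m, g⟫_ℝ = 0 := by
        rw [hgb]
        refine Finset.sum_eq_zero fun n _ => if_neg ?_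
        have := n.2
        omega
      rw [h1, sub_zero]
      exact hsmall ((hσe.antitone hm).trans hN)
  have hrest : ENNReal.ofReal (‖F - g‖ ^ 2) ≤ ENNReal.ofReal (τ * ‖f‖ ^ 2) := by
    rw [← tsum_ofReal_inner_sq b]
    refine ENNReal.tsum_le_of_sum_range_le fun M => ?_
    rw [← ENNReal.ofReal_sum_of_nonneg fun j _ => sq_nonneg _]
    refine ENNReal.ofReal_le_ofReal ((Finset.sum_le_sum fun m _ => hcoef m).trans ?_)
    rw [← Finset.mul_sum]
    gcongr
    exact hbessel _
  calc _ ≤ ∫⁻ x, (2 * ENNReal.ofReal (‖g - lsApprox hk ω x g‖ ^ 2) +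
          2 * ENNReal.ofReal (‖F - g‖ ^ 2)) ∂(dppLaw ω e N) := by
        refine lintegral_mono fun x => ?_
        refine (ENNReal.ofReal_le_ofReal
          (norm_sub_starProjection_sq_le (kernelSpan hk ω x) F g)).trans_eq ?_
        rw [ENNReal.ofReal_add (by positivity) (by positivity), ENNReal.ofReal_mul zero_le_two,
          ENNReal.ofReal_mul zero_le_two, ENNReal.ofReal_ofNat]
        rfl
    _ = 2 * ∫⁻ x, ENNReal.ofReal (‖g - lsApprox hk ω x g‖ ^ 2) ∂(dppLaw ω e N) +
          2 * ENNReal.ofReal (‖F - g‖ ^ 2) := by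
        rw [lintegral_add_right _ measurable_const, lintegral_const, measure_univ, mul_one,
          lintegral_const_mul' _ _ (by simp)]
    _ ≤ _ := by
        gcongr
        exact (hσe.lintegral_norm_sub_lsApprox_le hk v).trans (by gcongr)

end DPPSampling

/-- The integrability clause ensures that the Bochner integral is the true expectation, not its
default value `0`. -/
theorem mainTheorem9 {X : Type*} [MetricSpace X] [MeasurableSpace X] [BorelSpace X]
    (ω : Measure X) [IsFiniteMeasure ω] [ω.IsOpenPosMeasure]
    (k : X → X → ℝ) (hk : DPPSampling.IsAdmissibleKernel k)
    {H : Type*} [NormedAddCommGroup H] [InnerProductSpace ℝ H] [CompleteSpace H]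
    [RKHS ℝ H X ℝ] (hH : DPPSampling.HasKernel H k)
    (σ : ℕ → ℝ) (b : HilbertBasis ℕ ℝ (Lp ℝ 2 ω)) (e : ℕ → X → ℝ)
    (hσe : DPPSampling.IsEigensystem k ω σ b e)
    (s : ℝ) (hs : 1 / 2 < s) (hσ : ∀ m : ℕ, σ m = ((m : ℝ) + 1) ^ (-2 * s))
    (f : H) :
    (∀ N : ℕ, Integrable
      (fun x : Fin N → X =>
        ‖(hH.memLp hk ω f).toLp - DPPSampling.lsApprox hk ω x (hH.memLp hk ω f).toLp‖ ^ 2)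
      (DPPSampling.dppLaw ω e N)) ∧
    (fun N : ℕ => ∫ x : Fin N → X,
        ‖(hH.memLp hk ω f).toLp - DPPSampling.lsApprox hk ω x (hH.memLp hk ω f).toLp‖ ^ 2
        ∂(DPPSampling.dppLaw ω e N))
      =O[atTop] fun N : ℕ => (N : ℝ) ^ (1 / 2 - 2 * s) := by
  have hint : ∀ N : ℕ, Integrable
      (fun x : Fin N → X =>
        ‖(hH.memLp hk ω f).toLp - DPPSampling.lsApprox hk ω x (hH.memLp hk ω f).toLp‖ ^ 2)
      (DPPSampling.dppLaw ω e N) := fun N => by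
    have := hσe.isProbabilityMeasure_dppLaw N
    exact DPPSampling.integrable_norm_sub_lsApprox_sq hk hH b _ _
  refine ⟨hint, IsBigO.of_bound (4 * ‖f‖ ^ 2) ?_⟩
  filter_upwards [eventually_ge_atTop 1] with N hN
  have hN0 : (0 : ℝ) < N := by exact_mod_cast hN
  have hN1 : (1 : ℝ) ≤ N := by exact_mod_cast hN
  -- Chosen so that `τ²` is the tail bound `N^(1 - 4s)`: the total `2 τ² ‖f‖² / τ + 2 τ ‖f‖²` is `4
  -- ‖f‖² τ`. The `(N + 1)`-st eigenvalue `σ N` stays below `τ`.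
  set τ : ℝ := (N : ℝ) ^ (1 / 2 - 2 * s) with hτ
  have hτ0 : 0 < τ := Real.rpow_pos_of_pos hN0 _
  have hσN : σ N ≤ τ := by
    rw [hσ, hτ]
    calc ((N : ℝ) + 1) ^ (-2 * s) ≤ (N : ℝ) ^ (-2 * s) :=
          Real.rpow_le_rpow_of_nonpos hN0 (by linarith) (by linarith)
      _ ≤ _ := Real.rpow_le_rpow_of_exponent_le hN1 (by linarith)
  have htail : ∑' j : ℕ, ENNReal.ofReal (σ (j + N) ^ 2) ≤ ENNReal.ofReal (τ ^ 2) := by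
    have h1 : ∀ j : ℕ, σ (j + N) ^ 2 = (((j + N : ℕ) : ℝ) + 1) ^ (-(4 * s)) := fun j => by
      rw [hσ, ← Real.rpow_natCast, ← Real.rpow_mul (by positivity)]
      congr 1
      push_cast
      ring
    have h2 : τ ^ 2 = (N : ℝ) ^ (1 - 4 * s) := by
      rw [hτ, ← Real.rpow_natCast, ← Real.rpow_mul hN0.le]
      congr 1
      push_cast
      ring
    simp_rw [h1]
    rw [h2]
    exact DPPSampling.tsum_ofReal_rpow_le (by linarith) hN
  rw [Real.norm_of_nonneg (integral_nonneg fun x => by positivity), Real.norm_of_nonneg hτ0.le,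
    ← ENNReal.ofReal_le_ofReal_iff (by positivity),
    ofReal_integral_eq_lintegral_ofReal (hint N) (Eventually.of_forall fun x => by positivity)]
  refine (hσe.lintegral_norm_sub_lsApprox_rkhs_le hk hH f hτ0 hσN).trans ?_
  have h2 : (2 : ENNReal) = ENNReal.ofReal 2 := by simp
  calc _ ≤ 2 * (ENNReal.ofReal (τ ^ 2) * ENNReal.ofReal (‖f‖ ^ 2 / τ)) +
        2 * ENNReal.ofReal (τ * ‖f‖ ^ 2) := by gcongr
    _ = ENNReal.ofReal (4 * ‖f‖ ^ 2 * τ) := by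
        rw [h2, ← ENNReal.ofReal_mul (by positivity), ← ENNReal.ofReal_mul (by positivity),
          ← ENNReal.ofReal_mul (by positivity), ← ENNReal.ofReal_add (by positivity)
          (by positivity)]
        congr 1
        field_simp
        ring
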